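/- For an integral domain $R$ with quotient field $F$ and a nonzero fractional ideal $I$ of $R$, put $I^{-1}=\{x\in F : xI\subseteq R\}$ and $I_v=(I^{-1})^{-1}$. Call $I$ a $v$-ideal if $I_v=I$, and $v$-invertible if $(II^{-1})_v=R$. The $v$-invertible fractional $v$-ideals of $R$ form an abelian group under $I\cdot_v J=(IJ)_v$, and the $v$-class group $\mathcal C_v(R)$ is its quotient by the subgroup of nonzero principal fractional ideals. A numerical monoid is a submonoid $S$ of $(\mathbb N_0,+)$ (so $0\in S$) such that $\mathbb N_0\setminus S$ is finite. For a field $L$ and a commutative monoid $\Gamma$, $L[\Gamma]$ denotes the monoid algebra of $\Gamma$ over $L$. Let $K$ be a field, $n>1$ an integer, and $S_1,\ldots,S_n$ numerical monoids. Then there is an isomorphism of abelian groups \[ \mathcal C_v\Bigl(K\bigl[\bigoplus_{i=1}^n S_i\bigr]\Bigr)\;\cong\;\bigoplus_{i=1}^n \mathcal C_v\bigl(K(X_1,\ldots,X_{n-1})[S_i]\bigr), \] where $K(X_1,\ldots,X_{n-1})$ is the field of rational functions over $K$ in $n-1$ indeterminates. -/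

import Mathlib

open scoped nonZeroDivisors DirectSum

noncomputable section

namespace VClass

section VOperation

variable {R F : Type*} [CommRing R] [IsDomain R] [Field F] [Algebra R F] [IsFractionRing R F]

/-- The `v`-operation `I ↦ I_v = (I⁻¹)⁻¹` on fractional ideals of a domain `R` with quotient
field `F`, where `I⁻¹ = {x ∈ F | x I ⊆ R}` for nonzero `I`. -/
def vClosure (I : FractionalIdeal R⁰ F) : FractionalIdeal R⁰ F := (I⁻¹)⁻¹

theorem inv_ne_zero' {I : FractionalIdeal R⁰ F} (hI : I ≠ 0) : I⁻¹ ≠ 0 := by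
  intro h
  have := FractionalIdeal.bot_lt_mul_inv (K := F) (R₁ := R) (I := I) hI
  rw [h, mul_zero] at this
  exact lt_irrefl _ this

theorem mul_ne_zero' {I J : FractionalIdeal R⁰ F} (hI : I ≠ 0) (hJ : J ≠ 0) : I * J ≠ 0 := by
  obtain ⟨x, hx, hx0⟩ := FractionalIdeal.exists_ne_zero_mem_isInteger hI
  obtain ⟨y, hy, hy0⟩ := FractionalIdeal.exists_ne_zero_mem_isInteger hJ
  intro h
  have := FractionalIdeal.mul_mem_mul hx0 hy0
  rw [h, FractionalIdeal.mem_zero_iff] at this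
  exact mul_ne_zero (by simpa using hx) (by simpa using hy) this

theorem le_inv_iff {I J : FractionalIdeal R⁰ F} (hI : I ≠ 0) : J ≤ I⁻¹ ↔ J * I ≤ 1 := by
  rw [FractionalIdeal.inv_eq, FractionalIdeal.le_div_iff_mul_le hI]

theorem le_vClosure {I : FractionalIdeal R⁰ F} (hI : I ≠ 0) : I ≤ vClosure I := by
  rw [vClosure, le_inv_iff (inv_ne_zero' hI), mul_comm]
  exact (le_inv_iff hI).1 le_rfl

theorem vClosure_ne_zero {I : FractionalIdeal R⁰ F} (hI : I ≠ 0) : vClosure I ≠ 0 :=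
  inv_ne_zero' (inv_ne_zero' hI)

theorem inv_vClosure {I : FractionalIdeal R⁰ F} (hI : I ≠ 0) : (vClosure I)⁻¹ = I⁻¹ :=
  le_antisymm (FractionalIdeal.inv_anti_mono hI (vClosure_ne_zero hI) (le_vClosure hI))
    (le_vClosure (inv_ne_zero' hI))

theorem vClosure_vClosure {I : FractionalIdeal R⁰ F} (hI : I ≠ 0) :
    vClosure (vClosure I) = vClosure I := by
  rw [vClosure, inv_vClosure hI, vClosure]

theorem vClosure_one : vClosure (1 : FractionalIdeal R⁰ F) = 1 := by
  simp [vClosure]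

theorem vClosure_vClosure_mul {I J : FractionalIdeal R⁰ F} (hI : I ≠ 0) (hJ : J ≠ 0) :
    vClosure (vClosure I * J) = vClosure (I * J) := by
  have h : (vClosure I * J)⁻¹ = (I * J)⁻¹ := by
    refine eq_of_forall_le_iff fun M => ?_
    rw [le_inv_iff (mul_ne_zero' (vClosure_ne_zero hI) hJ), le_inv_iff (mul_ne_zero' hI hJ),
      mul_comm (vClosure I), ← mul_assoc, ← le_inv_iff (vClosure_ne_zero hI), inv_vClosure hI,
      le_inv_iff hI, mul_assoc, mul_comm J]
  rw [vClosure, h, vClosure]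

theorem vClosure_mul_vClosure {I J : FractionalIdeal R⁰ F} (hI : I ≠ 0) (hJ : J ≠ 0) :
    vClosure (I * vClosure J) = vClosure (I * J) := by
  rw [mul_comm, vClosure_vClosure_mul hJ hI, mul_comm]

end VOperation

section Group

variable (R F : Type*) [CommRing R] [IsDomain R] [Field F] [Algebra R F] [IsFractionRing R F]

/-- The `v`-invertible fractional `v`-ideals of a domain `R` with quotient field `F`: nonzero
fractional ideals `I` with `I_v = I` and `(I I⁻¹)_v = R`. -/
@[ext]
structure VInvertibleIdeal where
  toIdeal : FractionalIdeal R⁰ F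
  ne_zero : toIdeal ≠ 0
  isVIdeal : vClosure toIdeal = toIdeal
  vInvertible : vClosure (toIdeal * toIdeal⁻¹) = 1

variable {R F}

/-- The product `I ·_v J = (I J)_v` is again a `v`-invertible `v`-ideal. -/
theorem vInvertible_mul {I J : FractionalIdeal R⁰ F} (hI : I ≠ 0) (hJ : J ≠ 0)
    (hI' : vClosure (I * I⁻¹) = 1) (hJ' : vClosure (J * J⁻¹) = 1) :
    vClosure (vClosure (I * J) * (vClosure (I * J))⁻¹) = 1 := by
  have hIJ := mul_ne_zero' hI hJ
  have hi := inv_ne_zero' hI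
  have hj := inv_ne_zero' hJ
  rw [inv_vClosure hIJ, vClosure_vClosure_mul hIJ (inv_ne_zero' hIJ)]
  have hle : I⁻¹ * J⁻¹ ≤ (I * J)⁻¹ := by
    rw [le_inv_iff hIJ, mul_mul_mul_comm]
    exact (mul_le_mul' ((le_inv_iff hI).1 le_rfl) ((le_inv_iff hJ).1 le_rfl)).trans
      (mul_one 1).le
  have hprod : vClosure ((I * J) * (I⁻¹ * J⁻¹)) = 1 := by
    rw [mul_mul_mul_comm, ← vClosure_vClosure_mul (mul_ne_zero' hI hi) (mul_ne_zero' hJ hj), hI',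
      one_mul, hJ']
  have hne := mul_ne_zero' hIJ (mul_ne_zero' hi hj)
  have hne' := mul_ne_zero' hIJ (inv_ne_zero' hIJ)
  have mono : ∀ {A B : FractionalIdeal R⁰ F}, A ≠ 0 → B ≠ 0 → A ≤ B → vClosure A ≤ vClosure B :=
    fun hA hB h => FractionalIdeal.inv_anti_mono (inv_ne_zero' hB) (inv_ne_zero' hA)
      (FractionalIdeal.inv_anti_mono hA hB h)
  apply le_antisymm
  · have := mono hne' one_ne_zero
      ((mul_comm _ _).le.trans ((le_inv_iff hIJ).1 (le_refl (I * J)⁻¹)))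
    rwa [vClosure_one] at this
  · rw [← hprod]
    exact mono hne hne' (mul_le_mul' le_rfl hle)

/-- The group of `v`-invertible fractional `v`-ideals under the `v`-multiplication
`I ·_v J = (I J)_v`, with neutral element `R` and inverses `I⁻¹`. -/
instance : CommGroup (VInvertibleIdeal R F) where
  mul I J :=
    { toIdeal := vClosure (I.toIdeal * J.toIdeal)
      ne_zero := vClosure_ne_zero (mul_ne_zero' I.ne_zero J.ne_zero)
      isVIdeal := vClosure_vClosure (mul_ne_zero' I.ne_zero J.ne_zero)
      vInvertible := vInvertible_mul I.ne_zero J.ne_zero I.vInvertible J.vInvertible }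
  one :=
    { toIdeal := 1
      ne_zero := one_ne_zero
      isVIdeal := vClosure_one
      vInvertible := by rw [inv_one, mul_one, vClosure_one] }
  inv I :=
    { toIdeal := I.toIdeal⁻¹
      ne_zero := inv_ne_zero' I.ne_zero
      isVIdeal := inv_vClosure I.ne_zero
      vInvertible := by
        have h : (I.toIdeal⁻¹)⁻¹ = I.toIdeal := I.isVIdeal
        rw [h, mul_comm]
        exact I.vInvertible }
  mul_assoc I J L := by
    apply VInvertibleIdeal.ext
    change vClosure (vClosure (I.toIdeal * J.toIdeal) * L.toIdeal) =
      vClosure (I.toIdeal * vClosure (J.toIdeal * L.toIdeal))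
    rw [vClosure_vClosure_mul (mul_ne_zero' I.ne_zero J.ne_zero) L.ne_zero,
      vClosure_mul_vClosure I.ne_zero (mul_ne_zero' J.ne_zero L.ne_zero), mul_assoc]
  one_mul I := by
    apply VInvertibleIdeal.ext
    change vClosure (1 * I.toIdeal) = I.toIdeal
    rw [one_mul, I.isVIdeal]
  mul_one I := by
    apply VInvertibleIdeal.ext
    change vClosure (I.toIdeal * 1) = I.toIdeal
    rw [mul_one, I.isVIdeal]
  inv_mul_cancel I := by
    apply VInvertibleIdeal.ext
    change vClosure (I.toIdeal⁻¹ * I.toIdeal) = 1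
    rw [mul_comm, I.vInvertible]
  mul_comm I J := by
    apply VInvertibleIdeal.ext
    change vClosure (I.toIdeal * J.toIdeal) = vClosure (J.toIdeal * I.toIdeal)
    rw [mul_comm]

theorem vClosure_spanSingleton (x : F) :
    vClosure (FractionalIdeal.spanSingleton R⁰ x) = FractionalIdeal.spanSingleton R⁰ x := by
  rw [vClosure, FractionalIdeal.spanSingleton_inv, FractionalIdeal.spanSingleton_inv, inv_inv]

variable (R F)

/-- The map sending `x ∈ F ∖ {0}` to the principal fractional ideal `xR`. -/
def principal : Fˣ →* VInvertibleIdeal R F where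
  toFun x :=
    { toIdeal := FractionalIdeal.spanSingleton R⁰ (x : F)
      ne_zero := FractionalIdeal.spanSingleton_ne_zero_iff.2 x.ne_zero
      isVIdeal := vClosure_spanSingleton _
      vInvertible := by
        rw [FractionalIdeal.spanSingleton_mul_inv F x.ne_zero, vClosure_one] }
  map_one' := by
    apply VInvertibleIdeal.ext
    change FractionalIdeal.spanSingleton R⁰ ((1 : Fˣ) : F) = 1
    simp
  map_mul' x y := by
    apply VInvertibleIdeal.ext
    change FractionalIdeal.spanSingleton R⁰ ((x * y : Fˣ) : F) =
      vClosure (FractionalIdeal.spanSingleton R⁰ (x : F) * FractionalIdeal.spanSingleton R⁰ (y : F))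
    rw [FractionalIdeal.spanSingleton_mul_spanSingleton, vClosure_spanSingleton, Units.val_mul]

end Group

/-- The `v`-class group `C_v(R)` of a domain `R`: the group of `v`-invertible fractional `v`-ideals
modulo the nonzero principal fractional ideals. -/
def VClassGroup (R : Type*) [CommRing R] [IsDomain R] : Type _ :=
  VInvertibleIdeal R (FractionRing R) ⧸ (principal R (FractionRing R)).range

instance (R : Type*) [CommRing R] [IsDomain R] : CommGroup (VClassGroup R) :=
  inferInstanceAs
    (CommGroup (VInvertibleIdeal R (FractionRing R) ⧸ (principal R (FractionRing R)).range))

end VClass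

/-- A submonoid of `ℕ` is a numerical monoid if its complement in `ℕ` is finite. -/
def IsNumericalMonoid (S : AddSubmonoid ℕ) : Prop := ((S : Set ℕ)ᶜ).Finite

instance {ι : Type*} (S : ι → AddSubmonoid ℕ) : TwoUniqueSums (⨁ i, S i) :=
  inferInstanceAs (TwoUniqueSums (Π₀ i, S i))

end

/-!
The `v`-class group of a numerical monoid algebra is computed explicitly, as a group of units of
power series rings, and both sides of the isomorphism turn out to be the same group.

The ring `R = K[⨁ i, S i]` sits in the factorial ring `A = K[X₁, …, Xₙ]`. Expanding a polynomial in
the variable `X i` over the field `L` of rational functions in the other variables gives ring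
homomorphisms `A → L⟦X⟧`, and `R` consists of the `a ∈ A` whose `i`-th expansion has all its
exponents in `S i`, for every `i`. The ring `L[S i]` inside `L[X]` is described by a single such
condition. `AxisExpansion` collects what is needed of this situation, and
`AxisExpansion.exists_surjective_toVClassGroup` shows that in it the `v`-class group of `R` is
`∏ i, L⟦X⟧ˣ ⧸ L⟦S i⟧ˣ`. The theorem follows, since the `i`-th factor is also the `v`-class group
of `L[S i]`.

To a tuple `u` of units of `L⟦X⟧` corresponds the fractional ideal
`I(u) = {a ∈ A | expand i a ∈ u i · L⟦S i⟧ for all i}`. Everything rests on the implication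
`y I(u) ⊆ I(w) → y ∈ I(w / u)` (`AxisExpansion.mem_twistedIdeal_of_forall_mul`): as `I(u)` has no
common prime factor in `A`, the fraction `y` lies in `A`, and as `I(u)` contains, by approximation,
an element generating `u i · L⟦S i⟧`, the `i`-th expansion of `y` is as required. Consequently
`I(u)⁻¹ = I(u⁻¹)` and `(I(u) I(w))_v = I(u w)`, so `u ↦ I(u)` is a homomorphism to the
`v`-invertible `v`-ideals. If `I(u)` is principal then it is generated by a unit of `A`, and units
of `A` lie in `R`; hence all `u i` are units of `L⟦S i⟧`.

Conversely, let `I` be a `v`-invertible `v`-ideal, scaled so that it lies in `A` and has no common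
prime factor there. Then `I⁻¹ ⊆ A`, and `I I⁻¹` is not contained in `X i A`, because otherwise
`(I I⁻¹)⁻¹` would be larger than `R` (`AxisExpansion.exists_mul_not_axis_dvd`). So there are
`x ∈ I` and `y ∈ I⁻¹` with `x y` prime to `X i`. With `u i` the expansion of `x`, both
`I ⊆ I(u)` and `I⁻¹ ⊆ I(u⁻¹)` hold, whence `I = I(u)`.
-/

noncomputable section

namespace NumericalMonoidAlgebra

open PowerSeries VClass

/-! ### Power series supported in a numerical monoid -/

/-- The ring `L⟦S⟧` of power series all of whose exponents lie in `S`, as a subring of `L⟦X⟧`. -/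
def supportedSeries (L : Type*) [Field L] (S : AddSubmonoid ℕ) : Subring L⟦X⟧ where
  carrier := {f | ∀ k, coeff k f ≠ 0 → k ∈ S}
  mul_mem' {f g} hf hg k hk := by
    rw [coeff_mul] at hk
    obtain ⟨p, hp, hne⟩ := Finset.exists_ne_zero_of_sum_ne_zero hk
    rw [← Finset.HasAntidiagonal.mem_antidiagonal.1 hp]
    exact S.add_mem (hf _ (left_ne_zero_of_mul hne)) (hg _ (right_ne_zero_of_mul hne))
  one_mem' k hk := by
    rw [coeff_one] at hk
    split_ifs at hk with h
    · exact h ▸ S.zero_mem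
    · exact absurd rfl hk
  add_mem' {f g} hf hg k hk := by
    by_contra hS
    have h1 : coeff k f = 0 := by_contra fun h => hS (hf k h)
    have h2 : coeff k g = 0 := by_contra fun h => hS (hg k h)
    simp [h1, h2] at hk
  zero_mem' k hk := by simp at hk
  neg_mem' {f} hf k hk := hf k (by simpa using hk)

section supportedSeries

variable {L : Type*} [Field L] {S : AddSubmonoid ℕ}

theorem C_mem_supportedSeries (c : L) : C c ∈ supportedSeries L S := by
  intro k hk
  rw [coeff_C] at hk
  split_ifs at hk with h
  · exact h ▸ S.zero_mem
  · exact absurd rfl hk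

/-- `L⟦S⟧` is inverse-closed in `L⟦X⟧`, so that its units are the units of `L⟦X⟧` lying in it. -/
theorem mem_supportedSeries_of_mul_eq_one {f g : L⟦X⟧} (hfg : f * g = 1)
    (hf : f ∈ supportedSeries L S) : g ∈ supportedSeries L S := by
  have hf0 : coeff 0 f ≠ 0 := by
    intro h
    have := congrArg (coeff 0) hfg
    simp [coeff_mul] at this h
    simp [h] at this
  intro k
  induction k using Nat.strong_induction_on with
  | _ k ih =>
    contrapose!
    intro hk
    have hk0 : k ≠ 0 := fun h => hk (h ▸ S.zero_mem)
    have h := congrArg (coeff k) hfg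
    rw [coeff_mul, coeff_one, if_neg hk0, Finset.sum_eq_single (0, k)] at h
    · exact (mul_eq_zero.1 h).resolve_left hf0
    · rintro ⟨a, b⟩ hab hne
      rw [Finset.HasAntidiagonal.mem_antidiagonal] at hab
      by_contra hprod
      have ha := hf a (left_ne_zero_of_mul hprod)
      have hb0 := right_ne_zero_of_mul hprod
      have hbk : b < k := by
        rcases Nat.eq_zero_or_pos a with rfl | h
        · exact absurd (by simp at hab; simp [hab]) hne
        · dsimp only at hab; omega
      exact hk (hab ▸ S.add_mem ha (ih b hbk hb0))
    · intro h
      simp at h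

theorem X_pow_mul_mem_supportedSeries {m : ℕ} (hm : ∀ k, m ≤ k → k ∈ S) (f : L⟦X⟧) :
    X ^ m * f ∈ supportedSeries L S := by
  intro k hk
  rw [coeff_X_pow_mul'] at hk
  split_ifs at hk with h
  · exact hm k h
  · exact absurd rfl hk

theorem isUnit_C_add_X_pow_mul {c : L} (hc : c ≠ 0) {N : ℕ} (hN : N ≠ 0) (f : L⟦X⟧) :
    IsUnit (C c + X ^ N * f) := by
  rw [isUnit_iff_constantCoeff]
  simpa [hN] using hc

end supportedSeries

theorem exists_forall_ge_mem {S : AddSubmonoid ℕ} (hS : IsNumericalMonoid S) :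
    ∃ N, ∀ k, N ≤ k → k ∈ S := by
  obtain ⟨b, hb⟩ := hS.bddAbove
  refine ⟨b + 1, fun k hk => by_contra fun h => ?_⟩
  have : k ≤ b := hb h
  omega

/-- A common exponent `N ≠ 0` beyond the conductors of all `S i`. -/
theorem exists_forall_forall_ge_mem {ι : Type*} [Fintype ι] {S : ι → AddSubmonoid ℕ}
    (hS : ∀ i, IsNumericalMonoid (S i)) : ∃ N : ℕ, N ≠ 0 ∧ ∀ i k, N ≤ k → k ∈ S i := by
  choose m hm using fun i => exists_forall_ge_mem (hS i)
  refine ⟨1 + ∑ i, m i, by omega, fun i k hk => hm i k ?_⟩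
  have := Finset.single_le_sum (f := m) (fun _ _ => Nat.zero_le _) (Finset.mem_univ i)
  omega

/-- The conductor of a numerical monoid: the least `m` with `m + ℕ ⊆ S`. -/
theorem exists_conductor {S : AddSubmonoid ℕ} (hS : IsNumericalMonoid S) :
    ∃ m, (∀ k, m ≤ k → k ∈ S) ∧ ∀ l, m = l + 1 → l ∉ S := by
  classical
  have h := exists_forall_ge_mem hS
  refine ⟨Nat.find h, Nat.find_spec h, fun l hl hlS => ?_⟩
  refine Nat.find_min h (m := l) (by omega) fun k hk => ?_
  rcases hk.eq_or_lt with rfl | hk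
  · exact hlS
  · exact Nat.find_spec h k (by omega)

/-! ### Rings cut out by conditions on axis expansions -/

/-- The data expressing `R` as the subring of a domain `A` cut out by conditions along finitely
many prime elements: each prime `axis i` comes with an expansion homomorphism `A → L⟦X⟧` in the
parameter `axis i`, and `R` consists of the elements all of whose expansions have exponents
in the numerical monoids `S i`. The expansions are dense only up to scalars from `L`, so that
`L` may be the field of fractions of the ring of coefficients that occur in them. -/
structure AxisExpansion (L R A : Type*) {ι : Type*} [Field L] [CommRing R] [CommRing A]
    (S : ι → AddSubmonoid ℕ) where
  incl : R →+* A
  axis : ι → A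
  expand : ι → A →+* L⟦X⟧
  isNumericalMonoid : ∀ i, IsNumericalMonoid (S i)
  incl_injective : Function.Injective incl
  prime_axis : ∀ i, Prime (axis i)
  expand_axis_self : ∀ i, expand i (axis i) = X
  expand_axis_of_ne : ∀ i j, j ≠ i → ∃ c : L, c ≠ 0 ∧ expand i (axis j) = C c
  axis_dvd : ∀ i a, constantCoeff (expand i a) = 0 → axis i ∣ a
  exists_approx : ∀ i (f : L⟦X⟧) (N : ℕ), ∃ a, ∃ c : L, c ≠ 0 ∧ X ^ N ∣ expand i a - C c * f
  exists_incl_eq : ∀ a, (∀ i, expand i a ∈ supportedSeries L (S i)) → ∃ r, incl r = a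
  expand_incl_mem : ∀ r i, expand i (incl r) ∈ supportedSeries L (S i)
  expand_unit_mem : ∀ a, IsUnit a → ∀ i, expand i a ∈ supportedSeries L (S i)

namespace AxisExpansion

variable {L R A ι : Type*} [Field L] [CommRing R] [CommRing A] {S : ι → AddSubmonoid ℕ}
  (E : AxisExpansion L R A S)

theorem isUnit_expand {i : ι} {a : A} (h : ¬ E.axis i ∣ a) : IsUnit (E.expand i a) := by
  rw [isUnit_iff_constantCoeff, isUnit_iff_ne_zero]
  exact fun h0 => h (E.axis_dvd i a h0)

theorem not_axis_dvd {i : ι} {a : A} (h : IsUnit (E.expand i a)) : ¬ E.axis i ∣ a := by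
  rintro ⟨b, rfl⟩
  rw [map_mul, E.expand_axis_self, isUnit_iff_constantCoeff] at h
  simp at h

theorem prod_axis_ne_zero [IsDomain A] (s : Finset ι) (N : ℕ) :
    ∏ j ∈ s, E.axis j ^ N ≠ 0 :=
  Finset.prod_ne_zero_iff.2 fun j _ => pow_ne_zero _ (E.prime_axis j).ne_zero

theorem expand_prod_of_notMem {i : ι} {s : Finset ι} (hi : i ∉ s) (N : ℕ) :
    ∃ c : L, c ≠ 0 ∧ E.expand i (∏ j ∈ s, E.axis j ^ N) = C c := by
  classical
  induction s using Finset.induction_on with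
  | empty => exact ⟨1, one_ne_zero, by simp⟩
  | insert j s hj ih =>
    obtain ⟨c, hc, h⟩ := ih fun h => hi (Finset.mem_insert_of_mem h)
    obtain ⟨d, hd, h'⟩ := E.expand_axis_of_ne i j (by rintro rfl; simp at hi)
    exact ⟨d ^ N * c, mul_ne_zero (pow_ne_zero _ hd) hc, by
      rw [Finset.prod_insert hj, map_mul, h, map_pow, h', map_mul, map_pow]⟩

theorem X_pow_dvd_expand_prod {i : ι} {s : Finset ι} (hi : i ∈ s) (N : ℕ) :
    X ^ N ∣ E.expand i (∏ j ∈ s, E.axis j ^ N) := by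
  have := map_dvd (E.expand i) (Finset.dvd_prod_of_mem (fun j => E.axis j ^ N) hi)
  rwa [map_pow, E.expand_axis_self] at this

/-- The condition `expand i a ∈ u i · L⟦S i⟧` for all `i`. -/
def Twisted (u : ι → (L⟦X⟧)ˣ) (a : A) : Prop :=
  ∀ i, E.expand i a * ((u i)⁻¹ : (L⟦X⟧)ˣ) ∈ supportedSeries L (S i)

variable {E} in
theorem Twisted.mul {u w : ι → (L⟦X⟧)ˣ} {a b : A} (ha : E.Twisted u a) (hb : E.Twisted w b) :
    E.Twisted (u * w) (a * b) := by
  intro i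
  have := (supportedSeries L (S i)).mul_mem (ha i) (hb i)
  convert this using 1
  simp only [map_mul, Pi.mul_apply, mul_inv, Units.val_mul]
  ring

theorem twisted_one_iff {a : A} : E.Twisted 1 a ↔ ∃ r, E.incl r = a := by
  simp only [Twisted, Pi.one_apply, inv_one, Units.val_one, mul_one]
  exact ⟨E.exists_incl_eq a, by rintro ⟨r, rfl⟩; exact E.expand_incl_mem r⟩

theorem twisted_of_X_pow_dvd {N : ℕ} (hN : ∀ i k, N ≤ k → k ∈ S i) (u : ι → (L⟦X⟧)ˣ) {a : A}
    (h : ∀ i, X ^ N ∣ E.expand i a) : E.Twisted u a := by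
  intro i
  obtain ⟨f, hf⟩ := h i
  rw [hf, mul_assoc]
  exact X_pow_mul_mem_supportedSeries (hN i) _

/-- Approximation: the twisted conditions for `u` have a solution that generates `u i · L⟦S i⟧`
at a given `i`. -/
theorem exists_twisted_generator [Fintype ι] (u : ι → (L⟦X⟧)ˣ) (i : ι) :
    ∃ a, E.Twisted u a ∧ IsUnit (E.expand i a) := by
  classical
  obtain ⟨N, hN0, hN⟩ := exists_forall_forall_ge_mem E.isNumericalMonoid
  obtain ⟨a, c, hc, f, hf⟩ := E.exists_approx i (u i) N
  obtain ⟨d, hd, hd'⟩ := E.expand_prod_of_notMem (Finset.notMem_erase i Finset.univ) N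
  have ha : E.expand i a * (((u i)⁻¹ : (L⟦X⟧)ˣ) : L⟦X⟧) =
      C c + X ^ N * (f * (((u i)⁻¹ : (L⟦X⟧)ˣ) : L⟦X⟧)) := by
    rw [sub_eq_iff_eq_add'.1 hf, add_mul, mul_assoc, Units.mul_inv, mul_one, mul_assoc]
  refine ⟨a * ∏ j ∈ Finset.univ.erase i, E.axis j ^ N, fun j => ?_, ?_⟩
  · by_cases hj : j = i
    · subst hj
      rw [map_mul, hd', mul_right_comm, ha]
      exact mul_mem (add_mem (C_mem_supportedSeries _)
        (X_pow_mul_mem_supportedSeries (hN j) _)) (C_mem_supportedSeries _)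
    · obtain ⟨g, hg⟩ := E.X_pow_dvd_expand_prod
        (Finset.mem_erase.2 ⟨hj, Finset.mem_univ j⟩) N
      rw [map_mul, hg, mul_left_comm, mul_assoc]
      exact X_pow_mul_mem_supportedSeries (hN j) _
  · rw [map_mul, hd']
    refine IsUnit.mul ?_ ((isUnit_iff_ne_zero.2 hd).map C)
    refine isUnit_of_mul_isUnit_left (y := (((u i)⁻¹ : (L⟦X⟧)ˣ) : L⟦X⟧)) ?_
    rw [ha]
    exact isUnit_C_add_X_pow_mul hc hN0 _

/-- The elements satisfying a twisted condition have no common prime factor: a power of the product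
of the axes is among them, so only an axis could be one, and none is by approximation. -/
theorem exists_twisted_not_dvd [IsDomain A] [Fintype ι] (u : ι → (L⟦X⟧)ˣ) {q : A} (hq : Prime q) :
    ∃ a, E.Twisted u a ∧ ¬ q ∣ a := by
  by_contra! h
  obtain ⟨N, -, hN⟩ := exists_forall_forall_ge_mem E.isNumericalMonoid
  have h1 := h (∏ j, E.axis j ^ N) (E.twisted_of_X_pow_dvd hN u fun i =>
    E.X_pow_dvd_expand_prod (Finset.mem_univ i) N)
  obtain ⟨i, -, hi⟩ := (hq.dvd_finsetProd_iff _).1 h1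
  have hi := hq.dvd_of_dvd_pow hi
  obtain ⟨a, ha, hau⟩ := E.exists_twisted_generator u i
  have hqu : IsUnit (E.expand i q) := isUnit_of_dvd_unit (map_dvd _ (h a ha)) hau
  obtain ⟨b, hb⟩ := hi
  rcases (E.prime_axis i).irreducible.isUnit_or_isUnit hb with hu | hu
  · exact hq.not_isUnit hu
  · exact E.not_axis_dvd hqu ((hu.dvd_mul_right).1 (hb ▸ dvd_rfl))

/-- If multiplication by `y` maps the `u`-twisted elements to `w`-twisted ones, then `y` is
`w / u`-twisted. -/
theorem Twisted.of_forall_mul [Fintype ι] {u w : ι → (L⟦X⟧)ˣ} {y : A}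
    (h : ∀ a, E.Twisted u a → E.Twisted w (y * a)) : E.Twisted (w * u⁻¹) y := by
  intro i
  obtain ⟨a, ha, hau⟩ := E.exists_twisted_generator u i
  have h1 := h a ha i
  have h2 := ha i
  obtain ⟨v, hv⟩ := hau.mul (u i)⁻¹.isUnit
  have h3 : ((v⁻¹ : (L⟦X⟧)ˣ) : L⟦X⟧) ∈ supportedSeries L (S i) :=
    mem_supportedSeries_of_mul_eq_one v.mul_inv (hv ▸ h2)
  convert mul_mem h1 h3 using 1
  rw [Units.eq_mul_inv_iff_mul_eq, hv]
  simp only [map_mul, Pi.mul_apply, Pi.inv_apply, mul_inv, inv_inv, Units.val_mul]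
  linear_combination (E.expand i y * E.expand i a * ((w i)⁻¹ : (L⟦X⟧)ˣ)) * (u i).mul_inv

end AxisExpansion

/-! ### Elements without common prime factor in a unique factorization domain -/

section UFD

variable {A F : Type*} [CommRing A] [IsDomain A] [UniqueFactorizationMonoid A] [Field F]
  [Algebra A F] [IsFractionRing A F]

/-- A fraction multiplying a set without common prime factor into `A` lies in `A`. -/
theorem exists_algebraMap_eq_of_forall_mul {p : A → Prop}
    (hp : ∀ q, Prime q → ∃ a, p a ∧ ¬ q ∣ a) {y : F}
    (hy : ∀ a, p a → ∃ b, algebraMap A F b = y * algebraMap A F a) :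
    ∃ b, algebraMap A F b = y := by
  obtain ⟨c, d, hcd, rfl⟩ := IsFractionRing.exists_reduced_fraction A y
  have hd0 : (d : A) ≠ 0 := nonZeroDivisors.coe_ne_zero d
  have hd : IsUnit (d : A) := by
    by_contra hdu
    obtain ⟨q, hq, hqd⟩ := WfDvdMonoid.exists_irreducible_factor hdu hd0
    have hq' : Prime q := hq.prime
    obtain ⟨a, ha, hqa⟩ := hp q hq'
    obtain ⟨b, hb⟩ := hy a ha
    have hbd : b * d = c * a := by
      apply IsFractionRing.injective A F
      rw [map_mul, map_mul, hb, mul_right_comm, IsLocalization.mk'_spec]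
    have hqc : q ∣ c := (hq'.dvd_or_dvd (hbd ▸ hqd.mul_left b)).resolve_right hqa
    exact hq'.not_isUnit (hcd hqc hqd)
  obtain ⟨e, he⟩ := hd.exists_right_inv
  refine ⟨c * e, ?_⟩
  rw [IsLocalization.eq_mk'_iff_mul_eq, ← map_mul, mul_assoc, mul_comm e, he, mul_one]

/-- Division of a set of elements of `A`, not all zero, by its greatest common divisor. -/
theorem exists_forall_dvd_and_forall_prime {p : A → Prop} (hp : ∃ a, p a ∧ a ≠ 0) :
    ∃ g, g ≠ 0 ∧ (∀ a, p a → g ∣ a) ∧ ∀ q, Prime q → ∃ b, p (g * b) ∧ ¬ q ∣ b := by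
  obtain ⟨a₀, ha₀, hne⟩ := hp
  obtain ⟨k, ⟨g, hgk, hg⟩, hmin⟩ :=
    (IsWellFounded.wf : WellFounded (DvdNotUnit (α := A))).has_min
      {k | ∃ g, a₀ = g * k ∧ ∀ a, p a → g ∣ a} ⟨a₀, 1, (one_mul _).symm, fun a _ => one_dvd a⟩
  have hg0 : g ≠ 0 := by rintro rfl; simp [hgk] at hne
  have hk0 : k ≠ 0 := by rintro rfl; simp [hgk] at hne
  refine ⟨g, hg0, hg, fun q hq => ?_⟩
  by_contra! h
  have hgq : ∀ a, p a → g * q ∣ a := by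
    intro a ha
    obtain ⟨b, rfl⟩ := hg a ha
    exact mul_dvd_mul_left g (h b ha)
  obtain ⟨k', hk'⟩ := hgq a₀ ha₀
  have hkk : k = k' * q := by
    apply mul_left_cancel₀ hg0
    rw [← hgk, hk']
    ring
  refine hmin k' ⟨g * q, hk', hgq⟩ ⟨?_, q, hq.not_isUnit, hkk⟩
  rintro rfl
  simp [hkk] at hk0

end UFD

/-! ### The fractional ideals attached to units of the power series rings -/

theorem inv_one_eq_of_vClosure_eq_one {R F : Type*} [CommRing R] [IsDomain R] [Field F]
    [Algebra R F] [IsFractionRing R F] {M : FractionalIdeal R⁰ F} (hM : M ≠ 0)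
    (h : vClosure M = 1) : M⁻¹ = 1 := by
  rw [← inv_vClosure hM, h, inv_one]

namespace AxisExpansion

variable {L R A ι : Type*} [Field L] [CommRing R] [CommRing A] {S : ι → AddSubmonoid ℕ}
  (E : AxisExpansion L R A S) [Fintype ι] [IsDomain R] [IsDomain A]
  {F : Type*} [Field F] [Algebra R F] [Algebra A F]
  (hE : ∀ r, algebraMap R F r = algebraMap A F (E.incl r))

/-- The fractional ideal of `R` consisting of the `a ∈ A` with `expand i a ∈ u i · L⟦S i⟧` for
all `i`. -/
def twistedIdeal (u : ι → (L⟦X⟧)ˣ) : FractionalIdeal R⁰ F :=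
  ⟨{ carrier := {y | ∃ a, E.Twisted u a ∧ algebraMap A F a = y}
     add_mem' := by
      rintro _ _ ⟨a, ha, rfl⟩ ⟨b, hb, rfl⟩
      refine ⟨a + b, fun i => ?_, map_add _ _ _⟩
      rw [map_add, add_mul]
      exact add_mem (ha i) (hb i)
     zero_mem' := ⟨0, fun i => by simp, map_zero _⟩
     smul_mem' := by
      rintro r _ ⟨a, ha, rfl⟩
      refine ⟨E.incl r * a, ?_, ?_⟩
      · simpa using (E.twisted_one_iff.2 ⟨r, rfl⟩).mul ha
      · rw [map_mul, ← hE, Algebra.smul_def] }, by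
    obtain ⟨N, -, hN⟩ := exists_forall_forall_ge_mem E.isNumericalMonoid
    have hdvd : ∀ i, X ^ N ∣ E.expand i (∏ j, E.axis j ^ N) := fun i =>
      E.X_pow_dvd_expand_prod (Finset.mem_univ i) N
    obtain ⟨r, hr⟩ := E.twisted_one_iff.1 (E.twisted_of_X_pow_dvd hN 1 hdvd)
    refine ⟨r, ?_, ?_⟩
    · rw [mem_nonZeroDivisors_iff_ne_zero]
      rintro rfl
      exact E.prod_axis_ne_zero Finset.univ N (by rw [← hr, map_zero])
    · rintro _ ⟨a, ha, rfl⟩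
      obtain ⟨s, hs⟩ := E.twisted_one_iff.1 (E.twisted_of_X_pow_dvd (a := E.incl r * a) hN 1
        fun i => by rw [map_mul, hr]; exact (hdvd i).mul_right _)
      exact ⟨s, by rw [hE, hs, map_mul, ← hE, Algebra.smul_def]⟩⟩

theorem mem_twistedIdeal {u : ι → (L⟦X⟧)ˣ} {y : F} :
    y ∈ E.twistedIdeal hE u ↔ ∃ a, E.Twisted u a ∧ algebraMap A F a = y := Iff.rfl

theorem twistedIdeal_mul_le (u w : ι → (L⟦X⟧)ˣ) :
    E.twistedIdeal hE u * E.twistedIdeal hE w ≤ E.twistedIdeal hE (u * w) := by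
  rw [FractionalIdeal.mul_le]
  rintro _ ⟨a, ha, rfl⟩ _ ⟨b, hb, rfl⟩
  exact ⟨a * b, ha.mul hb, map_mul _ _ _⟩

theorem twistedIdeal_one : E.twistedIdeal hE 1 = 1 := by
  ext y
  rw [mem_twistedIdeal, FractionalIdeal.mem_one_iff]
  constructor
  · rintro ⟨a, ha, rfl⟩
    obtain ⟨r, rfl⟩ := E.twisted_one_iff.1 ha
    exact ⟨r, hE r⟩
  · rintro ⟨r, rfl⟩
    exact ⟨E.incl r, E.twisted_one_iff.2 ⟨r, rfl⟩, (hE r).symm⟩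

variable [IsFractionRing A F]

theorem algebraMap_mem_twistedIdeal {u : ι → (L⟦X⟧)ˣ} {a : A} :
    algebraMap A F a ∈ E.twistedIdeal hE u ↔ E.Twisted u a := by
  rw [mem_twistedIdeal]
  refine ⟨?_, fun h => ⟨a, h, rfl⟩⟩
  rintro ⟨b, hb, hba⟩
  rwa [← IsFractionRing.injective A F hba]

theorem twistedIdeal_ne_zero (u : ι → (L⟦X⟧)ˣ) : E.twistedIdeal hE u ≠ 0 := by
  obtain ⟨N, -, hN⟩ := exists_forall_forall_ge_mem E.isNumericalMonoid
  intro h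
  have := (E.algebraMap_mem_twistedIdeal hE).2 (E.twisted_of_X_pow_dvd hN u fun i =>
    E.X_pow_dvd_expand_prod (Finset.mem_univ i) N)
  rw [h, FractionalIdeal.mem_zero_iff] at this
  exact E.prod_axis_ne_zero _ _ (IsFractionRing.injective A F (this.trans (map_zero _).symm))

/-- If `(I J)⁻¹ = R`, then the products `x * y` with `x ∈ I` and `y ∈ J` are not all divisible by
`axis i` in `A`. Otherwise they would be multiplied into `R` by the fraction
`axis i ^ m / axis i * ∏ j ≠ i, axis j ^ N`, with `m` the conductor of `S i`, which is not
in `R`. -/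
theorem exists_mul_not_axis_dvd [IsFractionRing R F]
    (hE : ∀ r, algebraMap R F r = algebraMap A F (E.incl r))
    {I J : FractionalIdeal R⁰ F} (hI : I ≠ 0) (hJ : J ≠ 0) (hIJ : (I * J)⁻¹ = 1) (i : ι) :
    ∃ x ∈ I, ∃ y ∈ J, ∀ a, algebraMap A F a = x * y → ¬ E.axis i ∣ a := by
  classical
  by_contra! h
  obtain ⟨N, -, hN⟩ := exists_forall_forall_ge_mem E.isNumericalMonoid
  obtain ⟨m, hm, hm'⟩ := exists_conductor (E.isNumericalMonoid i)
  obtain ⟨d, hd, hd'⟩ := E.expand_prod_of_notMem (Finset.notMem_erase i Finset.univ) N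
  set P := ∏ j ∈ Finset.univ.erase i, E.axis j ^ N with hP
  have hi0 : algebraMap A F (E.axis i) ≠ 0 := fun h0 => (E.prime_axis i).ne_zero
    (IsFractionRing.injective A F (h0.trans (map_zero _).symm))
  have hz : algebraMap A F (P * E.axis i ^ m) / algebraMap A F (E.axis i) ∈ (I * J)⁻¹ := by
    rw [← FractionalIdeal.spanSingleton_le_iff_mem, le_inv_iff (mul_ne_zero' hI hJ), ← mul_assoc,
      FractionalIdeal.mul_le]
    intro x' hx' y hy
    obtain ⟨x, hx, rfl⟩ := FractionalIdeal.mem_singleton_mul.1 hx'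
    obtain ⟨a, hxy, b, rfl⟩ := h x hx y hy
    rw [mul_assoc, ← hxy, ← E.twistedIdeal_one hE, map_mul _ (E.axis i), ← mul_assoc,
      div_mul_cancel₀ _ hi0, ← map_mul, algebraMap_mem_twistedIdeal]
    intro j
    rw [Pi.one_apply, inv_one, Units.val_one, mul_one]
    by_cases hj : j = i
    · subst hj
      rw [map_mul, map_mul, hd', map_pow, E.expand_axis_self, mul_assoc]
      exact mul_mem (C_mem_supportedSeries _) (X_pow_mul_mem_supportedSeries hm _)
    · obtain ⟨g, hg⟩ := E.X_pow_dvd_expand_prod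
        (Finset.mem_erase.2 ⟨hj, Finset.mem_univ j⟩) N
      rw [map_mul, map_mul, hP, hg, mul_assoc, mul_assoc]
      exact X_pow_mul_mem_supportedSeries (hN j) _
  rw [hIJ, FractionalIdeal.mem_one_iff] at hz
  obtain ⟨r, hr⟩ := hz
  have hr' : E.incl r * E.axis i = P * E.axis i ^ m := by
    apply IsFractionRing.injective A F
    rw [map_mul, ← hE, hr, div_mul_cancel₀ _ hi0]
  have hexp := congrArg (E.expand i) hr'
  rw [map_mul, map_mul, hd', map_pow, E.expand_axis_self] at hexp
  have hcoeff := congrArg (coeff m) hexp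
  rw [coeff_C_mul, coeff_X_pow_self, mul_one] at hcoeff
  cases m with
  | zero => simp at hcoeff; exact hd hcoeff.symm
  | succ l =>
    rw [coeff_succ_mul_X] at hcoeff
    exact hm' l rfl (E.expand_incl_mem r i l (hcoeff ▸ hd))

variable [UniqueFactorizationMonoid A]

theorem mem_twistedIdeal_of_forall_mul {u w : ι → (L⟦X⟧)ˣ} {y : F}
    (h : ∀ z ∈ E.twistedIdeal hE u, y * z ∈ E.twistedIdeal hE w) :
    y ∈ E.twistedIdeal hE (w * u⁻¹) := by
  obtain ⟨b, rfl⟩ := exists_algebraMap_eq_of_forall_mul (F := F) (y := y)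
    (fun q hq => E.exists_twisted_not_dvd u hq) fun a ha => by
      obtain ⟨b, -, hb⟩ := h _ ⟨a, ha, rfl⟩
      exact ⟨b, hb⟩
  rw [algebraMap_mem_twistedIdeal]
  refine Twisted.of_forall_mul E fun a ha => ?_
  rw [← E.algebraMap_mem_twistedIdeal hE, map_mul]
  exact h _ ⟨a, ha, rfl⟩

variable [IsFractionRing R F]

theorem inv_twistedIdeal (u : ι → (L⟦X⟧)ˣ) :
    (E.twistedIdeal hE u)⁻¹ = E.twistedIdeal hE u⁻¹ := by
  apply le_antisymm
  · intro y hy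
    rw [← one_mul u⁻¹]
    refine E.mem_twistedIdeal_of_forall_mul hE fun z hz => ?_
    rw [twistedIdeal_one]
    exact (FractionalIdeal.mem_inv_iff (E.twistedIdeal_ne_zero hE u)).1 hy z hz
  · rw [le_inv_iff (E.twistedIdeal_ne_zero hE u), ← E.twistedIdeal_one hE, ← inv_mul_cancel u]
    exact E.twistedIdeal_mul_le hE _ _

theorem vClosure_twistedIdeal (u : ι → (L⟦X⟧)ˣ) :
    vClosure (E.twistedIdeal hE u) = E.twistedIdeal hE u := by
  rw [vClosure, inv_twistedIdeal, inv_twistedIdeal, inv_inv]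

theorem vClosure_twistedIdeal_mul (u w : ι → (L⟦X⟧)ˣ) :
    vClosure (E.twistedIdeal hE u * E.twistedIdeal hE w) = E.twistedIdeal hE (u * w) := by
  have hu := E.twistedIdeal_ne_zero hE u
  have hw := E.twistedIdeal_ne_zero hE w
  have h : (E.twistedIdeal hE u * E.twistedIdeal hE w)⁻¹ = E.twistedIdeal hE (u * w)⁻¹ := by
    apply le_antisymm
    · intro y hy
      rw [FractionalIdeal.mem_inv_iff (mul_ne_zero' hu hw)] at hy
      rw [mul_inv_rev]
      refine E.mem_twistedIdeal_of_forall_mul hE fun z hz => ?_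
      rw [← one_mul w⁻¹]
      refine E.mem_twistedIdeal_of_forall_mul hE fun z' hz' => ?_
      rw [twistedIdeal_one, mul_assoc]
      exact hy _ (FractionalIdeal.mul_mem_mul hz hz')
    · rw [← inv_twistedIdeal]
      exact FractionalIdeal.inv_anti_mono (mul_ne_zero' hu hw) (E.twistedIdeal_ne_zero hE _)
        (E.twistedIdeal_mul_le hE u w)
  rw [vClosure, h, inv_twistedIdeal, inv_inv]

/-- The homomorphism `u ↦ {a ∈ A | expand i a ∈ u i · L⟦S i⟧ for all i}` to the group of
`v`-invertible `v`-ideals. -/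
def twistedIdealHom : (ι → (L⟦X⟧)ˣ) →* VInvertibleIdeal R F where
  toFun u :=
    { toIdeal := E.twistedIdeal hE u
      ne_zero := E.twistedIdeal_ne_zero hE u
      isVIdeal := E.vClosure_twistedIdeal hE u
      vInvertible := by
        rw [inv_twistedIdeal, vClosure_twistedIdeal_mul, mul_inv_cancel, twistedIdeal_one] }
  map_one' := VInvertibleIdeal.ext (E.twistedIdeal_one hE)
  map_mul' u w := VInvertibleIdeal.ext (E.vClosure_twistedIdeal_mul hE u w).symm

/-- A twisted ideal is principal only if every `u i` is a unit of `L⟦S i⟧`: a generator is a unit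
of `A`, hence of `R`. -/
theorem twistedIdealHom_mem_range_principal_iff {u : ι → (L⟦X⟧)ˣ} :
    E.twistedIdealHom hE u ∈ (principal R F).range ↔
      ∀ i, ((u i : (L⟦X⟧)ˣ) : L⟦X⟧) ∈ supportedSeries L (S i) := by
  constructor
  · rintro ⟨c, hc⟩ i
    have hc : FractionalIdeal.spanSingleton R⁰ (c : F) = E.twistedIdeal hE u :=
      congrArg VInvertibleIdeal.toIdeal hc
    have hc' : FractionalIdeal.spanSingleton R⁰ ((c : F)⁻¹) = E.twistedIdeal hE u⁻¹ := by
      rw [← FractionalIdeal.spanSingleton_inv, hc, inv_twistedIdeal]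
    obtain ⟨a, ha, hac⟩ := (E.mem_twistedIdeal hE).1
      (hc ▸ FractionalIdeal.mem_spanSingleton_self R⁰ (c : F))
    obtain ⟨b, hb, hbc⟩ := (E.mem_twistedIdeal hE).1
      (hc' ▸ FractionalIdeal.mem_spanSingleton_self R⁰ ((c : F)⁻¹))
    have hab : a * b = 1 := by
      apply IsFractionRing.injective A F
      rw [map_mul, hac, hbc, mul_inv_cancel₀ c.ne_zero, map_one]
    have h1 := mul_mem (E.expand_unit_mem a (IsUnit.of_mul_eq_one b hab) i) (hb i)
    rwa [← mul_assoc, ← map_mul, hab, map_one, one_mul, Pi.inv_apply, inv_inv] at h1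
  · intro hu
    refine ⟨1, ?_⟩
    rw [map_one]
    refine VInvertibleIdeal.ext ?_
    change (1 : FractionalIdeal R⁰ F) = E.twistedIdeal hE u
    rw [← E.twistedIdeal_one hE]
    have hu' := fun i => mem_supportedSeries_of_mul_eq_one (u i).mul_inv (hu i)
    have key : ∀ a, E.Twisted 1 a ↔ E.Twisted u a := fun a =>
      forall_congr' fun i => by
        rw [Pi.one_apply, inv_one, Units.val_one, mul_one]
        refine ⟨fun h => mul_mem h (hu' i), fun h => ?_⟩
        simpa [mul_assoc] using mul_mem h (hu i)
    ext y
    simp only [mem_twistedIdeal, key]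

/-- Every `v`-invertible `v`-ideal `I` is a principal multiple of a twisted ideal: once `I` is
scaled to lie in `A` without common prime factor, `I⁻¹` lies in `A` too; for each `i` some product
`x * y` with `x ∈ I` and `y ∈ I⁻¹` is prime to `axis i`, and `u i` is the expansion of `x`. -/
theorem exists_principal_mul_twistedIdealHom (P : VInvertibleIdeal R F) :
    ∃ c u, P = principal R F c * E.twistedIdealHom hE u := by
  set I := P.toIdeal
  have hI0 : I ≠ 0 := P.ne_zero
  have hJ0 : I⁻¹ ≠ 0 := inv_ne_zero' hI0
  have hII : (I⁻¹)⁻¹ = I := P.isVIdeal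
  -- a first scaling moves `I` into `A`
  obtain ⟨s, hs0, hs⟩ := I.isFractional
  have hs0' : algebraMap R F s ≠ 0 := IsFractionRing.to_map_ne_zero_of_mem_nonZeroDivisors hs0
  have hsA : ∀ x ∈ I, ∃ a, algebraMap A F a = algebraMap R F s * x := fun x hx => by
    obtain ⟨r, hr⟩ := hs x hx
    exact ⟨E.incl r, by rw [← hE, hr, Algebra.smul_def]⟩
  -- a second one removes the greatest common divisor
  obtain ⟨g, hg0, hgdvd, hgprime⟩ := exists_forall_dvd_and_forall_prime (A := A)
    (p := fun a => algebraMap A F a / algebraMap R F s ∈ I) (by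
      obtain ⟨x, hx0, hx⟩ := FractionalIdeal.exists_ne_zero_mem_isInteger hI0
      obtain ⟨a, ha⟩ := hsA _ hx
      refine ⟨a, by rwa [ha, mul_div_cancel_left₀ _ hs0'], ?_⟩
      rintro rfl
      rw [map_zero] at ha
      have := (mul_eq_zero.1 ha.symm).resolve_left hs0'
      exact hx0 (by simpa using this))
  have hg0' : algebraMap A F g ≠ 0 := fun h0 =>
    hg0 (IsFractionRing.injective A F (h0.trans (map_zero _).symm))
  obtain ⟨c, hc⟩ : ∃ c : Fˣ, (c : F) = algebraMap A F g / algebraMap R F s :=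
    ⟨Units.mk0 _ (div_ne_zero hg0' hs0'), rfl⟩
  have hIA : ∀ x ∈ I, ∃ a, x = c * algebraMap A F a := fun x hx => by
    obtain ⟨a, ha⟩ := hsA x hx
    obtain ⟨b, rfl⟩ := hgdvd a (by rwa [ha, mul_div_cancel_left₀ _ hs0'])
    refine ⟨b, ?_⟩
    rw [hc, div_mul_eq_mul_div, ← map_mul, ha, mul_div_cancel_left₀ _ hs0']
  have hprime : ∀ q : A, Prime q → ∃ a, (c : F) * algebraMap A F a ∈ I ∧ ¬ q ∣ a := fun q hq => by
    obtain ⟨b, hb, hqb⟩ := hgprime q hq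
    exact ⟨b, by rwa [hc, div_mul_eq_mul_div, ← map_mul], hqb⟩
  have hmem : ∀ x ∈ I, ∀ y ∈ I⁻¹, ∃ r, algebraMap R F r = x * y := fun x hx y hy => by
    rw [mul_comm]
    exact FractionalIdeal.mem_one_iff _ |>.1 ((FractionalIdeal.mem_inv_iff hI0).1 hy x hx)
  have hJA : ∀ y ∈ I⁻¹, ∃ b, algebraMap A F b = c * y := fun y hy =>
    exists_algebraMap_eq_of_forall_mul hprime fun a ha => by
      obtain ⟨r, hr⟩ := hmem _ ha y hy
      exact ⟨E.incl r, by rw [← hE, hr]; ring⟩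
  have hIJ : (I * I⁻¹)⁻¹ = 1 :=
    inv_one_eq_of_vClosure_eq_one (mul_ne_zero' hI0 hJ0) P.vInvertible
  choose x hx y hy hxy using E.exists_mul_not_axis_dvd hE hI0 hJ0 hIJ
  choose a ha using fun i => hIA (x i) (hx i)
  choose b hb using fun i => hJA (y i) (hy i)
  have hab : ∀ i, algebraMap A F (a i * b i) = x i * y i := fun i => by
    rw [map_mul, hb, ha]; ring
  have hua : ∀ i, IsUnit (E.expand i (a i)) := fun i =>
    E.isUnit_expand fun h => hxy i _ (hab i) (h.mul_right _)
  have hub : ∀ i, IsUnit (E.expand i (b i)) := fun i =>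
    E.isUnit_expand fun h => hxy i _ (hab i) (h.mul_left _)
  choose u hu using hua
  choose w hw using hub
  have huw : ∀ i, ((u i * w i : (L⟦X⟧)ˣ) : L⟦X⟧) ∈ supportedSeries L (S i) := fun i => by
    obtain ⟨r, hr⟩ := hmem _ (hx i) _ (hy i)
    rw [Units.val_mul, hu, hw, ← map_mul]
    rw [show a i * b i = E.incl r from IsFractionRing.injective A F (by rw [hab, ← hE, hr])]
    exact E.expand_incl_mem r i
  have huw' : ∀ i, (((u i * w i)⁻¹ : (L⟦X⟧)ˣ) : L⟦X⟧) ∈ supportedSeries L (S i) := fun i =>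
    mem_supportedSeries_of_mul_eq_one (u i * w i).mul_inv (huw i)
  have hcI : (c : F) ≠ 0 := c.ne_zero
  -- both `c⁻¹ I ⊆ I(u)` and `c I⁻¹ ⊆ I(u⁻¹)`
  have hle : ∀ z ∈ I, ∃ t ∈ E.twistedIdeal hE u, z = c * t := fun z hz => by
    obtain ⟨t, rfl⟩ := hIA z hz
    refine ⟨_, (E.algebraMap_mem_twistedIdeal hE).2 fun i => ?_, rfl⟩
    obtain ⟨r, hr⟩ := hmem _ hz _ (hy i)
    have htb : t * b i = E.incl r := IsFractionRing.injective A F (by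
      rw [map_mul, hb, ← hE, hr]; ring)
    have h1 := mul_mem (E.expand_incl_mem r i) (huw' i)
    rw [← htb, map_mul, ← hw] at h1
    convert h1 using 1
    rw [mul_inv_rev, Units.val_mul, mul_assoc, Units.mul_inv_cancel_left]
  have hle' : ∀ z ∈ I⁻¹, ∃ t ∈ E.twistedIdeal hE u⁻¹, z = (c : F)⁻¹ * t := fun z hz => by
    obtain ⟨t, ht⟩ := hJA z hz
    refine ⟨algebraMap A F t, (E.algebraMap_mem_twistedIdeal hE).2 fun i => ?_,
      by rw [ht, inv_mul_cancel_left₀ hcI]⟩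
    obtain ⟨r, hr⟩ := hmem _ (hx i) _ hz
    have htb : t * a i = E.incl r := IsFractionRing.injective A F (by
      rw [map_mul, ht, ← hE, hr, ha]; ring)
    have h1 := E.expand_incl_mem r i
    rw [← htb, map_mul, ← hu] at h1
    rwa [Pi.inv_apply, inv_inv]
  have hfin : I = FractionalIdeal.spanSingleton R⁰ (c : F) * E.twistedIdeal hE u := by
    apply le_antisymm
    · intro z hz
      exact FractionalIdeal.mem_singleton_mul.2 (hle z hz)
    · rw [← hII, le_inv_iff hJ0, mul_right_comm, mul_comm _ (E.twistedIdeal hE u),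
        ← E.twistedIdeal_one hE, FractionalIdeal.mul_le]
      intro t ht z' hz'
      obtain ⟨z, hz, rfl⟩ := FractionalIdeal.mem_singleton_mul.1 hz'
      obtain ⟨t', ht', rfl⟩ := hle' z hz
      have := E.twistedIdeal_mul_le hE _ _ (FractionalIdeal.mul_mem_mul ht ht')
      rw [mul_inv_cancel] at this
      convert this using 1
      field_simp
  refine ⟨c, u, VInvertibleIdeal.ext ?_⟩
  change I = vClosure (FractionalIdeal.spanSingleton R⁰ (c : F) * E.twistedIdeal hE u)
  rw [← hfin]
  exact P.isVIdeal.symm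

end AxisExpansion

/-! ### The class group as a quotient of a group of units -/

/-- The class of a `v`-invertible `v`-ideal. -/
def toVClassGroup (R : Type*) [CommRing R] [IsDomain R] :
    VInvertibleIdeal R (FractionRing R) →* VClassGroup R :=
  QuotientGroup.mk' (principal R (FractionRing R)).range

theorem toVClassGroup_surjective (R : Type*) [CommRing R] [IsDomain R] :
    Function.Surjective (toVClassGroup R) :=
  QuotientGroup.mk'_surjective _

theorem toVClassGroup_eq_one_iff {R : Type*} [CommRing R] [IsDomain R]
    {P : VInvertibleIdeal R (FractionRing R)} :
    toVClassGroup R P = 1 ↔ P ∈ (principal R (FractionRing R)).range :=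
  QuotientGroup.eq_one_iff P

namespace AxisExpansion

variable {L R A ι : Type*} [Field L] [CommRing R] [CommRing A] {S : ι → AddSubmonoid ℕ}
  (E : AxisExpansion L R A S) [Fintype ι] [IsDomain A]

/-- `A` and `R` have the same fraction field, as a power of the product of the axes multiplies `A`
into `R`. -/
theorem isFractionRing_of_algebraMap_eq [Algebra R (FractionRing A)]
    (hE : ∀ r, algebraMap R (FractionRing A) r = algebraMap A (FractionRing A) (E.incl r)) :
    IsFractionRing R (FractionRing A) := by
  have hinj : Function.Injective (algebraMap R (FractionRing A)) := fun r s h => by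
    rw [hE, hE] at h
    exact E.incl_injective (IsFractionRing.injective A (FractionRing A) h)
  have := (faithfulSMul_iff_algebraMap_injective R (FractionRing A)).2 hinj
  refine IsFractionRing.of_field R _ fun z => ?_
  obtain ⟨N, -, hN⟩ := exists_forall_forall_ge_mem E.isNumericalMonoid
  have key : ∀ a, ∃ r, E.incl r = (∏ j, E.axis j ^ N) * a := fun a =>
    E.twisted_one_iff.1 (E.twisted_of_X_pow_dvd hN 1 fun i => by
      rw [map_mul]
      exact (E.X_pow_dvd_expand_prod (Finset.mem_univ i) N).mul_right _)
  obtain ⟨a, b, -, rfl⟩ := IsFractionRing.div_surjective (A := A) z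
  obtain ⟨r, hr⟩ := key a
  obtain ⟨s, hs⟩ := key b
  have h0 : algebraMap A (FractionRing A) (∏ j, E.axis j ^ N) ≠ 0 := fun h =>
    E.prod_axis_ne_zero Finset.univ N
      (IsFractionRing.injective A (FractionRing A) (h.trans (map_zero _).symm))
  exact ⟨r, s, by rw [hE, hE, hr, hs, map_mul, map_mul, mul_div_mul_left _ _ h0]⟩

theorem exists_algebra_isFractionRing :
    ∃ _ : Algebra A (FractionRing R), IsFractionRing A (FractionRing R) ∧
      ∀ r, algebraMap R (FractionRing R) r = algebraMap A (FractionRing R) (E.incl r) := by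
  let _ : Algebra R (FractionRing A) := ((algebraMap A (FractionRing A)).comp E.incl).toAlgebra
  have := E.isFractionRing_of_algebraMap_eq fun _ => rfl
  let e : FractionRing R ≃ₐ[R] FractionRing A := FractionRing.algEquiv R (FractionRing A)
  let _ : Algebra A (FractionRing R) :=
    ((e.symm : FractionRing A →+* FractionRing R).comp (algebraMap A (FractionRing A))).toAlgebra
  refine ⟨inferInstance, ?_, fun r => (e.symm.commutes r).symm⟩
  exact IsLocalization.isLocalization_of_algEquiv A⁰
    (AlgEquiv.ofRingEquiv (f := e.symm.toRingEquiv) fun _ => rfl)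

variable [IsDomain R]

/-- The `v`-class group of `R` is the quotient of `∏ i, L⟦X⟧ˣ` by `∏ i, L⟦S i⟧ˣ`. -/
theorem exists_surjective_toVClassGroup (E : AxisExpansion L R A S)
    [UniqueFactorizationMonoid A] :
    ∃ φ : (ι → (L⟦X⟧)ˣ) →* VClassGroup R, Function.Surjective φ ∧
      ∀ u, φ u = 1 ↔ ∀ i, ((u i : (L⟦X⟧)ˣ) : L⟦X⟧) ∈ supportedSeries L (S i) := by
  obtain ⟨_, _, hE⟩ := E.exists_algebra_isFractionRing
  refine ⟨(toVClassGroup R).comp (E.twistedIdealHom hE), fun x => ?_, fun u => ?_⟩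
  · obtain ⟨P, rfl⟩ := toVClassGroup_surjective R x
    obtain ⟨c, u, rfl⟩ := E.exists_principal_mul_twistedIdealHom hE P
    refine ⟨u, ?_⟩
    rw [map_mul, toVClassGroup_eq_one_iff.2 ⟨c, rfl⟩, one_mul, MonoidHom.comp_apply]
  · rw [MonoidHom.comp_apply, toVClassGroup_eq_one_iff, twistedIdealHom_mem_range_principal_iff]

end AxisExpansion

/-! ### Numerical monoid algebras in one variable -/

section OneVariable

variable (L : Type*) [Field L] (T : AddSubmonoid ℕ)

/-- The embedding of `L[T]` into the polynomial ring `L[X]`. -/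
def toPolynomial : AddMonoidAlgebra L T →+* Polynomial L :=
  (Polynomial.toFinsuppIso L).symm.toRingHom.comp
    (AddMonoidAlgebra.mapDomainRingHom L T.subtype)

variable {L T}

theorem toPolynomial_injective : Function.Injective (toPolynomial L T) :=
  (Polynomial.toFinsuppIso L).symm.injective.comp
    (AddMonoidAlgebra.mapDomain_injective Subtype.val_injective)

theorem coeff_toPolynomial (f : AddMonoidAlgebra L T) (k : ℕ) :
    (toPolynomial L T f).coeff k = f.coeff.mapDomain Subtype.val k := rfl

theorem exists_toPolynomial_eq {p : Polynomial L} (hp : ∀ k, p.coeff k ≠ 0 → k ∈ T) :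
    ∃ f, toPolynomial L T f = p := by
  obtain ⟨g, hg⟩ := (Finsupp.mem_range_mapDomain_iff (M := L) (f := (Subtype.val : T → ℕ))
    Subtype.val_injective p.toFinsupp.coeff).2 fun k hk => by
      by_contra h
      exact hk ⟨⟨k, hp k h⟩, rfl⟩
  refine ⟨.ofCoeff g, Polynomial.ext fun k => ?_⟩
  rw [coeff_toPolynomial]
  exact DFunLike.congr_fun hg k

theorem mem_of_coeff_toPolynomial_ne_zero {f : AddMonoidAlgebra L T} {k : ℕ}
    (h : (toPolynomial L T f).coeff k ≠ 0) : k ∈ T := by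
  obtain ⟨x, rfl⟩ := Finsupp.mem_range_of_mapDomain_ne_zero h
  exact x.2

/-- `L[T]` as the ring of polynomials whose expansion at `X = 0` is supported in `T`. -/
def polynomialAxisExpansion (hT : IsNumericalMonoid T) :
    AxisExpansion L (AddMonoidAlgebra L T) (Polynomial L) (fun _ : Unit => T) where
  incl := toPolynomial L T
  axis _ := Polynomial.X
  expand _ := Polynomial.coeToPowerSeries.ringHom
  isNumericalMonoid _ := hT
  incl_injective := toPolynomial_injective
  prime_axis _ := Polynomial.prime_X
  expand_axis_self _ := Polynomial.coe_X
  expand_axis_of_ne i j h := absurd (Subsingleton.elim j i) h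
  axis_dvd _ a h := by
    rw [Polynomial.X_dvd_iff]
    simpa using h
  exists_approx _ f N := by
    refine ⟨trunc N f, 1, one_ne_zero, ?_⟩
    rw [X_pow_dvd_iff]
    intro m hm
    simp [coeff_trunc, hm]
  exists_incl_eq a h := exists_toPolynomial_eq fun k hk => h () k (by simpa using hk)
  expand_incl_mem r _ k hk := mem_of_coeff_toPolynomial_ne_zero (by simpa using hk)
  expand_unit_mem a ha _ := by
    obtain ⟨c, -, rfl⟩ := Polynomial.isUnit_iff.1 ha
    simpa using C_mem_supportedSeries c

end OneVariable

/-! ### Numerical monoid algebras in several variables -/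

section SeveralVariables

variable (K : Type*) [Field K] {m : ℕ} (S : Fin (m + 1) → AddSubmonoid ℕ)

/-- The embedding of `⨁ i, S i` into the monoid of exponent vectors. -/
def exponentHom : (⨁ i, S i) →+ (Fin (m + 1) →₀ ℕ) where
  toFun x := Finsupp.equivFunOnFinite.symm fun i => (x i : ℕ)
  map_zero' := by ext; simp
  map_add' x y := by ext; simp

theorem exponentHom_injective : Function.Injective (exponentHom S) := fun _ _ h =>
  DFinsupp.ext fun i => Subtype.ext (DFunLike.congr_fun h i)

theorem exists_exponentHom_eq {d : Fin (m + 1) →₀ ℕ} (hd : ∀ i, d i ∈ S i) :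
    ∃ x, exponentHom S x = d :=
  ⟨(DirectSum.addEquivProd fun i => S i).symm fun i => ⟨d i, hd i⟩, by ext; rfl⟩

/-- The embedding of `K[⨁ i, S i]` into the polynomial ring `K[X₀, …, Xₘ]`. -/
def toMvPolynomial : AddMonoidAlgebra K (⨁ i, S i) →+* MvPolynomial (Fin (m + 1)) K :=
  AddMonoidAlgebra.mapDomainRingHom K (exponentHom S)

variable {K S}

theorem toMvPolynomial_injective : Function.Injective (toMvPolynomial K S) :=
  AddMonoidAlgebra.mapDomain_injective (exponentHom_injective S)

theorem coeff_toMvPolynomial (f : AddMonoidAlgebra K (⨁ i, S i)) (d : Fin (m + 1) →₀ ℕ) :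
    (toMvPolynomial K S f).coeff d = f.coeff.mapDomain (exponentHom S) d := rfl

theorem exists_toMvPolynomial_eq {p : MvPolynomial (Fin (m + 1)) K}
    (hp : ∀ d ∈ p.support, ∀ i, d i ∈ S i) : ∃ f, toMvPolynomial K S f = p := by
  obtain ⟨g, hg⟩ := (Finsupp.mem_range_mapDomain_iff (M := K)
    (f := exponentHom S) (exponentHom_injective S) (AddMonoidAlgebra.coeff p)).2 fun d hd => by
      by_contra h
      exact hd (exists_exponentHom_eq S (hp d (MvPolynomial.mem_support_iff.2 h)))
  refine ⟨.ofCoeff g, MvPolynomial.ext _ _ fun d => ?_⟩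
  rw [coeff_toMvPolynomial]
  exact DFunLike.congr_fun hg d

theorem mem_of_mem_support_toMvPolynomial {f : AddMonoidAlgebra K (⨁ i, S i)}
    {d : Fin (m + 1) →₀ ℕ} (h : d ∈ (toMvPolynomial K S f).support) (i : Fin (m + 1)) :
    d i ∈ S i := by
  obtain ⟨x, rfl⟩ := Finsupp.mem_range_of_mapDomain_ne_zero (MvPolynomial.mem_support_iff.1 h)
  exact (x i).2

/-- Polynomials in `m + 1` variables as polynomials in the `i`-th one, with coefficients in the
polynomial ring in the other `m`, relabelled in order. -/
def isolateVariable (K : Type*) [Field K] (i : Fin (m + 1)) :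
    MvPolynomial (Fin (m + 1)) K ≃ₐ[K] Polynomial (MvPolynomial (Fin m) K) :=
  (MvPolynomial.renameEquiv K (finSuccEquiv' i)).trans (MvPolynomial.optionEquivLeft K (Fin m))

theorem isolateVariable_X_self (i : Fin (m + 1)) :
    isolateVariable K i (MvPolynomial.X i) = Polynomial.X := by
  simp [isolateVariable]

theorem isolateVariable_X_succAbove (i : Fin (m + 1)) (j : Fin m) :
    isolateVariable K i (MvPolynomial.X (i.succAbove j)) = Polynomial.C (MvPolynomial.X j) := by
  simp [isolateVariable]

theorem coeff_isolateVariable_ne_zero_iff (i : Fin (m + 1)) (p : MvPolynomial (Fin (m + 1)) K)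
    (k : ℕ) : (isolateVariable K i p).coeff k ≠ 0 ↔ ∃ d ∈ p.support, d i = k := by
  classical
  rw [← Polynomial.mem_support_iff]
  change k ∈ (MvPolynomial.optionEquivLeft K (Fin m)
    (MvPolynomial.rename (finSuccEquiv' i) p)).support ↔ _
  rw [MvPolynomial.support_optionEquivLeft,
    MvPolynomial.support_rename_of_injective (finSuccEquiv' i).injective, Finset.image_image,
    Finset.mem_image]
  refine exists_congr fun d => and_congr_right fun _ => ?_
  rw [Function.comp_apply, Finsupp.mapDomain_equiv_apply, finSuccEquiv'_symm_none]

/-- The expansion of a polynomial in the `i`-th variable over the field of rational functions in the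
others. -/
def expandVariable (K : Type*) [Field K] (i : Fin (m + 1)) :
    MvPolynomial (Fin (m + 1)) K →+* (FractionRing (MvPolynomial (Fin m) K))⟦X⟧ :=
  (Polynomial.coeToPowerSeries.ringHom.comp (Polynomial.mapRingHom (algebraMap _ _))).comp
    (isolateVariable K i : MvPolynomial (Fin (m + 1)) K →+* Polynomial (MvPolynomial (Fin m) K))

theorem expandVariable_apply (i : Fin (m + 1)) (p : MvPolynomial (Fin (m + 1)) K) :
    expandVariable K i p = ((isolateVariable K i p).map
      (algebraMap _ (FractionRing (MvPolynomial (Fin m) K))) : Polynomial _) := rfl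

theorem coeff_expandVariable (i : Fin (m + 1)) (p : MvPolynomial (Fin (m + 1)) K) (k : ℕ) :
    coeff k (expandVariable K i p) = algebraMap _ _ ((isolateVariable K i p).coeff k) := by
  rw [expandVariable_apply, Polynomial.coeff_coe, Polynomial.coeff_map]

theorem coeff_expandVariable_ne_zero_iff (i : Fin (m + 1)) (p : MvPolynomial (Fin (m + 1)) K)
    (k : ℕ) : coeff k (expandVariable K i p) ≠ 0 ↔ ∃ d ∈ p.support, d i = k := by
  rw [coeff_expandVariable, ← coeff_isolateVariable_ne_zero_iff, Ne, Ne,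
    FaithfulSMul.algebraMap_eq_zero_iff]

/-- `K[⨁ i, S i]` as the ring of polynomials whose expansion in each variable `X i` is supported
in `S i`. -/
def mvPolynomialAxisExpansion (hS : ∀ i, IsNumericalMonoid (S i)) :
    AxisExpansion (FractionRing (MvPolynomial (Fin m) K)) (AddMonoidAlgebra K (⨁ i, S i))
      (MvPolynomial (Fin (m + 1)) K) S where
  incl := toMvPolynomial K S
  axis := MvPolynomial.X
  expand := expandVariable K
  isNumericalMonoid := hS
  incl_injective := toMvPolynomial_injective
  prime_axis i := MvPolynomial.X_prime
  expand_axis_self i := by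
    rw [expandVariable_apply, isolateVariable_X_self, Polynomial.map_X, Polynomial.coe_X]
  expand_axis_of_ne i j h := by
    obtain ⟨j, rfl⟩ := Fin.exists_succAbove_eq h
    refine ⟨algebraMap (MvPolynomial (Fin m) K) _ (MvPolynomial.X j), ?_, ?_⟩
    · rw [Ne, FaithfulSMul.algebraMap_eq_zero_iff]
      exact MvPolynomial.X_ne_zero j
    · rw [expandVariable_apply, isolateVariable_X_succAbove, Polynomial.map_C, Polynomial.coe_C]
  axis_dvd i a h := by
    rw [← coeff_zero_eq_constantCoeff_apply, coeff_expandVariable,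
      FaithfulSMul.algebraMap_eq_zero_iff, ← Polynomial.X_dvd_iff,
      ← isolateVariable_X_self (K := K) i] at h
    exact (map_dvd_iff (isolateVariable K i)).1 h
  exists_approx i f N := by
    -- clear the denominators of a truncation of `f`
    obtain ⟨b, hb, hb'⟩ := IsLocalization.integerNormalization_spec
      (MvPolynomial (Fin m) K)⁰ (trunc N f)
    refine ⟨(isolateVariable K i).symm (IsLocalization.integerNormalization
      (MvPolynomial (Fin m) K)⁰ (trunc N f)), algebraMap _ _ b, ?_, ?_⟩
    · rw [Ne, FaithfulSMul.algebraMap_eq_zero_iff]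
      exact nonZeroDivisors.ne_zero hb
    · rw [X_pow_dvd_iff]
      intro k hk
      rw [expandVariable_apply, AlgEquiv.apply_symm_apply, hb', map_sub, Polynomial.coeff_coe,
        coeff_C_mul, Polynomial.coeff_smul, coeff_trunc, if_pos hk, Algebra.smul_def, sub_self]
  exists_incl_eq a h := exists_toMvPolynomial_eq fun d hd i =>
    h i (d i) ((coeff_expandVariable_ne_zero_iff i a (d i)).2 ⟨d, hd, rfl⟩)
  expand_incl_mem r i k hk := by
    obtain ⟨d, hd, rfl⟩ := (coeff_expandVariable_ne_zero_iff i _ k).1 hk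
    exact mem_of_mem_support_toMvPolynomial hd i
  expand_unit_mem a ha i k hk := by
    obtain ⟨d, hd, rfl⟩ := (coeff_expandVariable_ne_zero_iff i a k).1 hk
    obtain ⟨c, -, rfl⟩ := MvPolynomial.isUnit_iff_eq_C_of_isReduced.1 ha
    rw [MvPolynomial.mem_support_iff, MvPolynomial.coeff_C] at hd
    split_ifs at hd with h
    · rw [← h]
      exact (S i).zero_mem
    · exact absurd rfl hd

end SeveralVariables

theorem nonempty_addEquiv_of_surjective {G H H' : Type*} [AddGroup G] [AddGroup H] [AddGroup H']
    {f : G →+ H} {g : G →+ H'} (hf : Function.Surjective f) (hg : Function.Surjective g)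
    (h : ∀ x, f x = 0 ↔ g x = 0) : Nonempty (H ≃+ H') := by
  have hker : f.ker = g.ker := by
    ext x
    exact h x
  exact ⟨(QuotientAddGroup.quotientKerEquivOfSurjective f hf).symm.trans
    ((QuotientAddGroup.quotientAddEquivOfEq hker).trans
      (QuotientAddGroup.quotientKerEquivOfSurjective g hg))⟩

end NumericalMonoidAlgebra

end

open NumericalMonoidAlgebra in
theorem mainTheorem8 {K : Type*} [Field K] (n : ℕ) (hn : 1 < n)
    (S : Fin n → AddSubmonoid ℕ) (hS : ∀ i, IsNumericalMonoid (S i)) :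
    Nonempty
      (Additive (VClass.VClassGroup (AddMonoidAlgebra K (⨁ i, S i))) ≃+
        ⨁ i, Additive (VClass.VClassGroup
          (AddMonoidAlgebra (FractionRing (MvPolynomial (Fin (n - 1)) K)) (S i)))) := by
  obtain ⟨m, rfl⟩ : ∃ m, n = m + 1 := ⟨n - 1, by omega⟩
  change Nonempty (_ ≃+ ⨁ i, Additive (VClass.VClassGroup
    (AddMonoidAlgebra (FractionRing (MvPolynomial (Fin m) K)) (S i))))
  obtain ⟨φ, hφ, hφ'⟩ :=
    (mvPolynomialAxisExpansion (K := K) hS).exists_surjective_toVClassGroup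
  choose ψ hψ hψ' using fun i => (polynomialAxisExpansion
    (L := FractionRing (MvPolynomial (Fin m) K)) (hS i)).exists_surjective_toVClassGroup
  let g := AddMonoidHom.mk' (fun u : Additive (Fin (m + 1) → _) =>
    (DirectSum.addEquivProd fun i => Additive (VClass.VClassGroup
      (AddMonoidAlgebra (FractionRing (MvPolynomial (Fin m) K)) (S i)))).symm
      fun i => Additive.ofMul (ψ i fun _ => u.toMul i)) fun u w => by
    rw [← map_add]
    congr 1
    ext i
    exact congrArg Additive.ofMul ((ψ i).map_mul (fun _ => u.toMul i) fun _ => w.toMul i)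
  refine nonempty_addEquiv_of_surjective (f := MonoidHom.toAdditive φ) (g := g) hφ
    (fun y => ?_) fun u => ?_
  · choose u hu using fun i => hψ i ((DirectSum.addEquivProd _ y) i).toMul
    refine ⟨Additive.ofMul fun i => u i (), ?_⟩
    exact (AddEquiv.symm_apply_eq _).2 (funext fun i => congrArg Additive.ofMul (hu i))
  · refine (hφ' u.toMul).trans ?_
    have hg : g u = 0 ↔ (fun i => Additive.ofMul (ψ i fun _ => u.toMul i)) = 0 :=
      AddEquiv.map_eq_zero_iff (DirectSum.addEquivProd fun i => Additive (VClass.VClassGroup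
        (AddMonoidAlgebra (FractionRing (MvPolynomial (Fin m) K)) (S i)))).symm
    rw [hg, funext_iff]
    refine forall_congr' fun i => ?_
    refine Iff.trans ?_ (hψ' i fun _ => u.toMul i).symm
    exact ⟨fun h _ => h, fun h => h ()⟩
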